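/- **Definitions.** A metric space $Z$ is *Ahlfors regular* if for some $Q>0$ there are $c,C>0$ with $c\,r^Q\le \mathcal H^Q(B(x,r))\le C\,r^Q$ for all $x\in Z$ and all $0<r\le \operatorname{diam} Z$, where $\mathcal H^Q$ is the $Q$-dimensional Hausdorff measure. A homeomorphism $f:Z\to W$ of metric spaces is a *quasisymmetry* if there is a homeomorphism $\eta:[0,\infty)\to[0,\infty)$ with $\frac{d_W(f(x),f(y))}{d_W(f(x),f(z))}\le\eta\!\left(\frac{d_Z(x,y)}{d_Z(x,z)}\right)$ for all $x,y,z\in Z$ with $x\ne z$; $Z$ and $W$ are *quasisymmetrically equivalent* if there is a quasisymmetry from $Z$ onto $W$. Two metric spaces $X,Y$ are *bilipschitz equivalent* if there are a bijection $f:X\to Y$ and $C>0$ with $\frac1C d_X(x,x')\le d_Y(f(x),f(x'))\le C\,d_X(x,x')$ for all $x,x'\in X$. A *hyperbolic filling* of a compact metric space $Z$ is a graph built as follows. Choose $R>0$, $s>1$, $\delta>0$ and put $r_n=R s^{-n}$ for $n=0,1,2,\dots$. For each $n$ choose a set $P_n\subset Z$ whose distinct points have mutual distance at least $\delta r_n$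 and such that every point of $Z$ is at distance less than $r_n$ from $P_n$ (for instance, with $\delta=1$, a maximal $r_n$-separated set), where $P_0$ consists of a single point. The vertex set is the disjoint union of the levels $P_n$. Choose $\lambda>1$ and $\tau\ge1$. Two distinct vertices $p,q$ of the same level $n$ are joined by an edge if and only if the balls $B(p,\lambda r_n)$ and $B(q,\lambda r_n)$ intersect. Vertices $p$ of level $n$ and $q$ of level $n+1$ are joined if and only if, according to a convention fixed for the whole graph, either (a) the balls $B(p,\tau r_n)$ and $B(q,\tau r_{n+1})$ intersect, or (b) $B(q,\tau r_{n+1})\subseteq B(p,\tau r_n)$, where in case (b) it is required that $1+\frac{1+\tau}{s}\le\tau$ (for instance $\tau=2$, $s\ge6$). There are no other edges. The balls may be taken open or closed, independently for the edges within a level and for those between levels, but fixed for the whole graph. Such a graph is connected, and its vertex set carries the graph metric (the least number of edges of a path joining two vertices). **Corollary.** Let $Z$ and $W$ be compact, Ahlfors regular metric spaces. 1. If $Z$ and $W$ are quasisymmetrically equivalent, then for every hyperbolic filling $X=(V_X,E_X)$ of $Z$ and every hyperbolic filling $Y=(V_Y,E_Y)$ of $W$, the vertex sets $V_X$ and $V_Y$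 with their graph metrics are bilipschitz equivalent. 2. In particular, for any two hyperbolic fillings $X,X'$ of $Z$, the vertex sets $V_X$ and $V_{X'}$ are bilipschitz equivalent. -/

import Mathlib

open MeasureTheory
open scoped NNReal ENNReal

/-- `Z` is Ahlfors `Q`-regular for some exponent `Q > 0`: with `μH[Q]` the `Q`-dimensional
Hausdorff measure, `c r ^ Q ≤ μH[Q] (B(x, r)) ≤ C r ^ Q` for all `x` and `0 < r ≤ diam Z`. -/
def IsAhlforsRegular (Z : Type*) [MetricSpace Z] [MeasurableSpace Z] [BorelSpace Z] : Prop :=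
  ∃ Q : ℝ, 0 < Q ∧ ∃ c C : ℝ, 0 < c ∧ 0 < C ∧
    ∀ (x : Z) (r : ℝ), 0 < r → r ≤ Metric.diam (Set.univ : Set Z) →
      ENNReal.ofReal (c * r ^ Q) ≤ Measure.hausdorffMeasure Q (Metric.ball x r) ∧
      Measure.hausdorffMeasure Q (Metric.ball x r) ≤ ENNReal.ofReal (C * r ^ Q)

/-- A homeomorphism `f` is a quasisymmetry if there is a homeomorphism
`η : [0, ∞) → [0, ∞)` controlling all ratios of distances. -/
def IsQuasisymmetry {Z W : Type*} [MetricSpace Z] [MetricSpace W] (f : Z ≃ₜ W) : Prop :=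
  ∃ η : ℝ≥0 ≃ₜ ℝ≥0, ∀ x y z : Z, x ≠ z →
    nndist (f x) (f y) / nndist (f x) (f z) ≤ η (nndist x y / nndist x z)

/-- There is a quasisymmetry from `Z` onto `W`. -/
def QuasisymmetricallyEquivalent (Z W : Type*) [MetricSpace Z] [MetricSpace W] : Prop :=
  ∃ f : Z ≃ₜ W, IsQuasisymmetry f

/-- There is a bijection that distorts distances by at most a multiplicative constant. -/
def BilipschitzEquivalent (X Y : Type*) [MetricSpace X] [MetricSpace Y] : Prop :=
  ∃ f : X → Y, Function.Bijective f ∧ ∃ C : ℝ, 0 < C ∧ ∀ x x' : X,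
    (1 / C) * dist x x' ≤ dist (f x) (f x') ∧ dist (f x) (f x') ≤ C * dist x x'

/-- Constructions of hyperbolic fillings in the literature use open or closed balls. -/
inductive BallKind
  | openBalls
  | closedBalls

/-- The ball with given centre and radius, open or closed. -/
def BallKind.ball {Z : Type*} [MetricSpace Z] : BallKind → Z → ℝ → Set Z
  | .openBalls => Metric.ball
  | .closedBalls => Metric.closedBall

/-- Constructions of hyperbolic fillings in the literature join vertices of consecutive levels
either if their balls overlap or if the smaller ball is contained in the larger one. -/
inductive VerticalRule
  | overlap
  | containment

/-- The condition on the ball `A` of level `n` and the ball `B` of level `n + 1`. -/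
def VerticalRule.holds {Z : Type*} : VerticalRule → Set Z → Set Z → Prop
  | .overlap, A, B => (A ∩ B).Nonempty
  | .containment, A, B => B ⊆ A

/-- The data of a (rooted) hyperbolic filling of a bounded metric space `Z`.

With `r n = scale / ratio ^ n`, level `n` consists of the points of a `sep * r n`-separated subset
`net n` of `Z` whose open `r n`-balls cover `Z` (so every maximal `r n`-separated set is allowed,
with `sep = 1`); level `0` has a single vertex, the root.  The vertex given by `p ∈ net n` stands
for balls centred at `p` whose radii are fixed multiples of `r n`.  Two vertices of the same level
are joined if their balls overlap; two vertices of consecutive levels are joined if their balls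
overlap or, in the other usual convention, if the smaller ball is contained in the larger one. -/
structure HyperbolicFilling (Z : Type*) [MetricSpace Z] where
  /-- the radius at level `0` -/
  scale : ℝ
  scale_pos : 0 < scale
  /-- the factor between the radii of consecutive levels -/
  ratio : ℝ
  one_lt_ratio : 1 < ratio
  /-- the separation constant -/
  sep : ℝ
  sep_pos : 0 < sep
  /-- the centres of the balls of level `n` -/
  net : ℕ → Set Z
  net_zero : ∃ p : Z, net 0 = {p}
  separated : ∀ n, (net n).Pairwise fun p q => sep * (scale / ratio ^ n) ≤ dist p q
  covers : ∀ (n : ℕ) (z : Z), ∃ p ∈ net n, dist z p < scale / ratio ^ n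
  /-- open or closed balls, for edges within one level -/
  hKind : BallKind
  /-- the multiple of `r n` that is the radius, for edges within one level -/
  hFactor : ℝ
  one_lt_hFactor : 1 < hFactor
  /-- open or closed balls, for edges between consecutive levels -/
  vKind : BallKind
  /-- the multiple of `r n` that is the radius, for edges between consecutive levels -/
  vFactor : ℝ
  one_le_vFactor : 1 ≤ vFactor
  /-- overlap or containment -/
  vRule : VerticalRule
  /-- for the containment rule the balls are large enough: if `z` is within `r n` of the centre of
  a ball of level `n` and within `r (n + 1)` of the centre of a ball of level `n + 1`, then the
  former ball contains the latter; the usual choice is `vFactor = 2` and `ratio ≥ 6` -/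
  vFactor_large : vRule = .containment → 1 + (1 + vFactor) / ratio ≤ vFactor

namespace HyperbolicFilling

variable {Z : Type*} [MetricSpace Z] (X : HyperbolicFilling Z)

/-- The vertex set: the disjoint union of the levels `net n`. -/
@[ext]
structure Vertex where
  /-- the level of the vertex -/
  level : ℕ
  /-- the centre of the associated ball -/
  center : Z
  mem : center ∈ X.net level

/-- The ball of the vertex `v` used for edges within one level. -/
def hBall (v : X.Vertex) : Set Z :=
  X.hKind.ball v.center (X.hFactor * (X.scale / X.ratio ^ v.level))

/-- The ball of the vertex `v` used for edges between consecutive levels. -/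
def vBall (v : X.Vertex) : Set Z :=
  X.vKind.ball v.center (X.vFactor * (X.scale / X.ratio ^ v.level))

/-- The graph on the vertex set. -/
def graph : SimpleGraph X.Vertex where
  Adj v w := v ≠ w ∧
    ((v.level = w.level ∧ (X.hBall v ∩ X.hBall w).Nonempty) ∨
      (w.level = v.level + 1 ∧ X.vRule.holds (X.vBall v) (X.vBall w)) ∨
      (v.level = w.level + 1 ∧ X.vRule.holds (X.vBall w) (X.vBall v)))
  symm := ⟨by
    rintro v w ⟨hne, h⟩
    refine ⟨hne.symm, ?_⟩
    rcases h with ⟨h1, h2⟩ | h | h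
    · exact Or.inl ⟨h1.symm, by rwa [Set.inter_comm]⟩
    · exact Or.inr (Or.inr h)
    · exact Or.inr (Or.inl h)⟩
  loopless := ⟨fun _ h => h.1 rfl⟩

theorem radius_pos (n : ℕ) : 0 < X.scale / X.ratio ^ n :=
  div_pos X.scale_pos (pow_pos (lt_trans one_pos X.one_lt_ratio) n)

/-- Every vertex of positive level has a neighbour in the preceding level. -/
theorem exists_parent (n : ℕ) (w : X.Vertex) (hw : w.level = n + 1) :
    ∃ v : X.Vertex, v.level = n ∧ X.graph.Adj v w := by
  obtain ⟨p, hp, hd⟩ := X.covers n w.center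
  have hr := X.radius_pos n
  have hs : 0 < X.ratio := lt_trans one_pos X.one_lt_ratio
  have hv := X.one_le_vFactor
  refine ⟨⟨n, p, hp⟩, rfl, fun h => ?_, Or.inr (Or.inl ⟨hw, ?_⟩)⟩
  · have h1 := congrArg Vertex.level h
    simp only at h1
    omega
  · have hr1 := X.radius_pos (n + 1)
    have hstep : X.scale / X.ratio ^ (n + 1) = X.scale / X.ratio ^ n / X.ratio := by
      rw [pow_succ, div_div]
    set r := X.scale / X.ratio ^ n
    cases hrule : X.vRule with
    | overlap =>
      refine ⟨w.center, ?_, ?_⟩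
      · cases hk : X.vKind
        · simp only [vBall, hk, BallKind.ball, Metric.mem_ball]
          nlinarith
        · simp only [vBall, hk, BallKind.ball, Metric.mem_closedBall]
          nlinarith
      · cases hk : X.vKind
        · simp only [vBall, hk, BallKind.ball, Metric.mem_ball, dist_self, hw]
          positivity
        · simp only [vBall, hk, BallKind.ball, Metric.mem_closedBall, dist_self, hw]
          positivity
    | containment =>
      have hlarge := X.vFactor_large hrule
      have key : X.vFactor * (r / X.ratio) + dist w.center p ≤ X.vFactor * r := by
        have h2 : X.vFactor * (r / X.ratio) = X.vFactor / X.ratio * r := by ring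
        have h3 : X.vFactor / X.ratio ≤ (1 + X.vFactor) / X.ratio := by gcongr; linarith
        nlinarith
      cases hk : X.vKind
      · simp only [VerticalRule.holds, vBall, hk, BallKind.ball, hw, hstep]
        exact Metric.ball_subset_ball' key
      · simp only [VerticalRule.holds, vBall, hk, BallKind.ball, hw, hstep]
        exact Metric.closedBall_subset_closedBall' key

theorem graph_connected : X.graph.Connected := by
  obtain ⟨p, hp⟩ := X.net_zero
  let o : X.Vertex := ⟨0, p, by rw [hp]; rfl⟩
  have key : ∀ (n : ℕ) (w : X.Vertex), w.level = n → X.graph.Reachable o w := by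
    intro n
    induction n with
    | zero =>
      rintro ⟨l, q, hq⟩ hl
      simp only at hl
      subst hl
      have hqp : q = p := by
        rw [hp] at hq
        exact hq
      subst hqp
      exact SimpleGraph.Reachable.refl _
    | succ n ih =>
      intro w hw
      obtain ⟨v, hvl, hvw⟩ := X.exists_parent n w hw
      exact (ih v hvl).trans hvw.reachable
  exact SimpleGraph.connected_iff_exists_forall_reachable _ |>.2 ⟨o, fun w => key _ w rfl⟩

/-- The vertex set with the graph metric: the distance of two vertices is the least number of
edges of a path that joins them. -/
noncomputable instance : MetricSpace X.Vertex where
  dist v w := (X.graph.dist v w : ℝ)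
  dist_self v := by simp
  dist_comm v w := by rw [SimpleGraph.dist_comm]
  dist_triangle u v w := by exact_mod_cast X.graph_connected.dist_triangle
  eq_of_dist_eq_zero h := X.graph_connected.dist_eq_zero_iff.1 (by exact_mod_cast h)

end HyperbolicFilling

/-!
In a uniformly perfect space balls correspond coarsely to pairs of distinct points, and the vertices
of a hyperbolic filling are representatives of the balls: two vertices are at bounded distance if
and only if their balls have comparable radii and centres at comparable distance. A quasisymmetry
preserves comparability of the balls given by pairs of points, so it induces a Lipschitz map between
the vertex sets, and its inverse induces a coarse inverse of this map.

By doubling, the vertex set has bounded geometry. By uniform perfectness every vertex has two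
descendants a fixed number of levels below it, and separation of the levels keeps the descendants of
distinct vertices distinct. So there is arbitrarily much room to move the values of a map with
finite fibres by a bounded amount until it becomes injective. Doing this for both coarse inverses
and applying the Schröder–Bernstein construction gives a bijection at bounded distance from the
Lipschitz map, hence a bilipschitz one. A one-point space is an exception: its fillings are
isometric to `ℕ`.
-/

section CoarseGeometry

theorem encard_le_of_forall_finset_card_le {α : Type*} {s : Set α} {N : ℕ}
    (h : ∀ A : Finset α, (A : Set α) ⊆ s → A.card ≤ N) : s.encard ≤ N := by
  by_contra! hlt
  obtain ⟨t, hts, ht⟩ := Set.exists_subset_encard_eq (Order.add_one_le_of_lt hlt)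
  have hfin : t.Finite := Set.finite_of_encard_eq_coe (k := N + 1) (by simpa using ht)
  rw [hfin.encard_eq_coe_toFinset_card] at ht
  have hcard : hfin.toFinset.card = N + 1 := by exact_mod_cast ht
  have := h hfin.toFinset (by simpa using hts)
  omega

theorem dist_le_mul_graphDist {V Y : Type*} [PseudoMetricSpace Y] {G : SimpleGraph V}
    (hG : G.Connected) {F : V → Y} {L : ℝ} (h : ∀ v w, G.Adj v w → dist (F v) (F w) ≤ L)
    (v w : V) : dist (F v) (F w) ≤ L * G.dist v w := by
  have hwalk : ∀ {v w} (p : G.Walk v w), dist (F v) (F w) ≤ L * p.length := by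
    intro v w p
    induction p with
    | nil => simp
    | @cons v u w huv p ih =>
      rw [SimpleGraph.Walk.length_cons, Nat.cast_succ]
      linarith [h v u huv, dist_triangle (F v) (F u) (F w)]
  obtain ⟨p, hp⟩ := hG.exists_walk_length_eq_dist v w
  exact hp ▸ hwalk p

/-- Two maps into a metric space are close if they are at bounded uniform distance. -/
def IsClose {ι Y : Type*} [PseudoMetricSpace Y] (F H : ι → Y) : Prop :=
  ∃ D : ℝ, ∀ x, dist (F x) (H x) ≤ D

namespace IsClose

variable {ι Y Y' : Type*} [PseudoMetricSpace Y] [PseudoMetricSpace Y'] {F H I : ι → Y}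

theorem symm (h : IsClose F H) : IsClose H F :=
  h.imp fun _ hD x => dist_comm (F x) (H x) ▸ hD x

theorem trans (h : IsClose F H) (h' : IsClose H I) : IsClose F I := by
  obtain ⟨D, hD⟩ := h
  obtain ⟨D', hD'⟩ := h'
  exact ⟨D + D', fun x => (dist_triangle _ (H x) _).trans (add_le_add (hD x) (hD' x))⟩

theorem comp_right {κ : Type*} (h : IsClose F H) (u : κ → ι) : IsClose (F ∘ u) (H ∘ u) :=
  h.imp fun _ hD x => hD (u x)

theorem comp_left {K : ℝ≥0} {G : Y → Y'} (hG : LipschitzWith K G) (h : IsClose F H) :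
    IsClose (G ∘ F) (G ∘ H) := by
  obtain ⟨D, hD⟩ := h
  exact ⟨K * D, fun x =>
    (hG.dist_le_mul _ _).trans (mul_le_mul_of_nonneg_left (hD x) K.coe_nonneg)⟩

end IsClose

/-- Distinct points have distances bounded away from zero. -/
def IsUniformlyDiscrete (X : Type*) [PseudoMetricSpace X] : Prop :=
  ∃ δ : ℝ, 0 < δ ∧ ∀ x x' : X, x ≠ x' → δ ≤ dist x x'

/-- A uniformly discrete space has bounded geometry if the number of points of a ball is bounded
in terms of its radius. -/
def HasBoundedGeometry (X : Type*) [PseudoMetricSpace X] : Prop :=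
  ∀ r : ℝ, ∃ N : ℕ, ∀ x : X, (Metric.closedBall x r).encard ≤ N

/-- Every point can be replaced by two points at bounded distance, with all the new points
distinct. For a space of bounded geometry this says that it is not amenable. -/
def IsParadoxical (X : Type*) [PseudoMetricSpace X] : Prop :=
  ∃ ι : X × Bool → X, Function.Injective ι ∧ IsClose ι Prod.fst

variable {X Y : Type*}

theorem IsClose.exists_lipschitzWith [PseudoMetricSpace X] [PseudoMetricSpace Y] {F H : X → Y}
    {K : ℝ≥0} (h : IsClose F H) (hX : IsUniformlyDiscrete X) (hF : LipschitzWith K F) :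
    ∃ K', LipschitzWith K' H := by
  obtain ⟨D, hD⟩ := h
  obtain ⟨δ, hδ, hsep⟩ := hX
  refine ⟨_, LipschitzWith.of_dist_le' (K := K + 2 * D / δ) fun x x' => ?_⟩
  rcases eq_or_ne x x' with rfl | hne
  · simp
  have hD0 : 0 ≤ D := dist_nonneg.trans (hD x)
  calc dist (H x) (H x')
      ≤ dist (F x) (H x) + dist (F x) (F x') + dist (F x') (H x') := by
        rw [dist_comm (F x) (H x)]
        exact dist_triangle4 _ _ _ _
    _ ≤ D + K * dist x x' + D := by gcongr; exacts [hD x, hF.dist_le_mul x x', hD x']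
    _ = K * dist x x' + 2 * D / δ * δ := by field_simp; ring
    _ ≤ K * dist x x' + 2 * D / δ * dist x x' := by gcongr; exact hsep x x' hne
    _ = (K + 2 * D / δ) * dist x x' := by ring

theorem bilipschitzEquivalent_of_lipschitzWith [MetricSpace X] [MetricSpace Y] {K K' : ℝ≥0}
    (h : X ≃ Y) (hK : LipschitzWith K h) (hK' : LipschitzWith K' h.symm) :
    BilipschitzEquivalent X Y := by
  refine ⟨h, h.bijective, K + K' + 1, by positivity, fun x x' => ⟨?_, ?_⟩⟩
  · rw [one_div, inv_mul_le_iff₀ (by positivity)]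
    calc dist x x' ≤ K' * dist (h x) (h x') := by simpa using hK'.dist_le_mul (h x) (h x')
      _ ≤ (K + K' + 1) * dist (h x) (h x') := by gcongr; linarith [K.coe_nonneg]
  · calc dist (h x) (h x') ≤ K * dist x x' := hK.dist_le_mul x x'
      _ ≤ (K + K' + 1) * dist x x' := by gcongr; linarith [K'.coe_nonneg]

theorem bilipschitzEquivalent_of_isClose_injective [MetricSpace X] [MetricSpace Y]
    (hX : IsUniformlyDiscrete X) (hY : IsUniformlyDiscrete Y) {F φ : X → Y} {G ψ : Y → X}
    {K K' : ℝ≥0} (hF : LipschitzWith K F) (hG : LipschitzWith K' G) (hGF : IsClose (G ∘ F) id)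
    (hFG : IsClose (F ∘ G) id) (hφ : Function.Injective φ) (hFφ : IsClose F φ)
    (hψ : Function.Injective ψ) (hGψ : IsClose G ψ) : BilipschitzEquivalent X Y := by
  obtain ⟨D₁, hD₁⟩ := hFφ
  obtain ⟨D₂, hD₂⟩ : IsClose (F ∘ ψ) id := (hGψ.symm.comp_left hF).trans hFG
  obtain ⟨h, hbij, hFh⟩ := Function.Embedding.schroeder_bernstein_of_rel hφ hψ
    (fun x y => dist (F x) y ≤ max D₁ D₂) (fun x => (hD₁ x).trans (le_max_left _ _))
    (fun y => (hD₂ y).trans (le_max_right _ _))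
  set e : X ≃ Y := Equiv.ofBijective h hbij
  have hFe : IsClose F e := ⟨max D₁ D₂, hFh⟩
  have hGe : IsClose (G ∘ e) id := (hFe.symm.comp_left hG).trans hGF
  have hGe' : IsClose G e.symm := by simpa [Function.comp_assoc] using hGe.comp_right e.symm
  obtain ⟨L, hL⟩ := hFe.exists_lipschitzWith hX hF
  obtain ⟨L', hL'⟩ := hGe'.exists_lipschitzWith hY hG
  exact bilipschitzEquivalent_of_lipschitzWith e hL hL'

theorem IsParadoxical.exists_injective_isClose_fst [PseudoMetricSpace X] (hX : IsParadoxical X)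
    (n : ℕ) : ∃ ι : X × Fin n → X, Function.Injective ι ∧ IsClose ι Prod.fst := by
  obtain ⟨β, hβ, D, hD⟩ := hX
  induction n with
  | zero => exact ⟨fun p => p.1, fun p => p.2.elim0, 0, fun p => p.2.elim0⟩
  | succ n ih =>
    obtain ⟨ι, hι, E, hE⟩ := ih
    refine ⟨fun p => Fin.cases (β (p.1, false)) (fun i => β (ι (p.1, i), true)) p.2, ?_,
      max D (D + E), ?_⟩
    · rintro ⟨x, i⟩ ⟨x', i'⟩ h
      cases i using Fin.cases <;> cases i' using Fin.cases <;>
        simp_all [hβ.eq_iff, hι.eq_iff]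
    · rintro ⟨x, i⟩
      cases i using Fin.cases with
      | zero => exact (hD _).trans (le_max_left _ _)
      | succ i =>
        exact ((dist_triangle _ _ _).trans (add_le_add (hD (ι (x, i), true)) (hE (x, i)))).trans
          (le_max_right _ _)

theorem exists_injective_isClose_of_isClose_id [PseudoMetricSpace X] [PseudoMetricSpace Y]
    (hX : HasBoundedGeometry X) (hY : IsParadoxical Y) {F : X → Y} {G : Y → X}
    (hGF : IsClose (G ∘ F) id) : ∃ φ : X → Y, Function.Injective φ ∧ IsClose F φ := by
  obtain ⟨D, hD⟩ := hGF
  obtain ⟨N, hN⟩ := hX (2 * D)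
  obtain ⟨ι, hι, E, hE⟩ := hY.exists_injective_isClose_fst (N + 1)
  have hfibre : ∀ y, (F ⁻¹' {y}).encard ≤ N := by
    intro y
    rcases (F ⁻¹' {y}).eq_empty_or_nonempty with h | ⟨x, rfl⟩
    · simp [h]
    refine (Set.encard_le_encard fun x' (hx' : F x' = F x) => ?_).trans (hN x)
    have h₁ : dist (G (F x)) x' ≤ D := hx' ▸ hD x'
    rw [Metric.mem_closedBall]
    linarith [dist_triangle_left x' x (G (F x)), show dist (G (F x)) x ≤ D from hD x]
  have hcoloring : ∀ y, ∃ g : X → Fin (N + 1), Set.InjOn g (F ⁻¹' {y}) := by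
    intro y
    obtain ⟨g, -, hg⟩ := Set.Finite.exists_injOn_of_encard_le
      (t := (Set.univ : Set (Fin (N + 1)))) (Set.finite_of_encard_le_coe (hfibre y))
      ((hfibre y).trans (by simp [Set.encard_univ]))
    exact ⟨g, hg⟩
  choose g hg using hcoloring
  refine ⟨fun x => ι (F x, g (F x) x), fun x x' h => ?_, E, fun x => ?_⟩
  · obtain ⟨hF, hgx⟩ := Prod.ext_iff.1 (hι h)
    simp only at hF hgx
    rw [← hF] at hgx
    exact hg (F x) rfl hF.symm hgx
  · rw [dist_comm]
    exact hE (F x, g (F x) x)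

-- Whyte's theorem on quasi-isometries of non-amenable spaces.
theorem bilipschitzEquivalent_of_isParadoxical [MetricSpace X] [MetricSpace Y]
    (hX : IsUniformlyDiscrete X) (hX' : HasBoundedGeometry X) (hX'' : IsParadoxical X)
    (hY : IsUniformlyDiscrete Y) (hY' : HasBoundedGeometry Y) (hY'' : IsParadoxical Y)
    {F : X → Y} {G : Y → X} {K K' : ℝ≥0} (hF : LipschitzWith K F) (hG : LipschitzWith K' G)
    (hGF : IsClose (G ∘ F) id) (hFG : IsClose (F ∘ G) id) : BilipschitzEquivalent X Y := by
  obtain ⟨φ, hφ, hFφ⟩ := exists_injective_isClose_of_isClose_id hX' hY'' hGF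
  obtain ⟨ψ, hψ, hGψ⟩ := exists_injective_isClose_of_isClose_id hY' hX'' hFG
  exact bilipschitzEquivalent_of_isClose_injective hX hY hF hG hGF hFG hφ hFφ hψ hGψ

end CoarseGeometry

section MetricNotions

/-- Quantitative doubling: a ball contains a bounded number of points whose mutual distances are
at least a fixed multiple of its radius. This is equivalent to the usual definition by coverings
with balls of half the radius. -/
def IsDoubling (Z : Type*) [PseudoMetricSpace Z] : Prop :=
  ∀ T : ℝ, ∃ N : ℕ, ∀ (x : Z) (r : ℝ), 0 < r → ∀ A : Finset Z, (∀ a ∈ A, dist a x ≤ T * r) →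
    (A : Set Z).Pairwise (fun a b => r ≤ dist a b) → A.card ≤ N

/-- Every ball whose complement is nonempty contains a point at distance comparable to its radius
from the centre. -/
def IsUniformlyPerfect (Z : Type*) [PseudoMetricSpace Z] : Prop :=
  ∃ c : ℝ, 0 < c ∧ ∀ (x z : Z) (r : ℝ), 0 < r → r ≤ dist x z →
    ∃ y, dist x y ∈ Set.Ico (c * r) r

theorem card_mul_le_measure_ball {Z : Type*} [PseudoMetricSpace Z] [MeasurableSpace Z]
    [OpensMeasurableSpace Z] (μ : Measure Z) {m : ℝ≥0∞} {x : Z} {r s : ℝ} {A : Finset Z}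
    (hA : ∀ a ∈ A, dist a x ≤ s) (hsep : (A : Set Z).Pairwise fun a b => r ≤ dist a b)
    (hm : ∀ a ∈ A, m ≤ μ (Metric.ball a (r / 2))) :
    A.card * m ≤ μ (Metric.ball x (s + r / 2)) := by
  have hdisj : (A : Set Z).PairwiseDisjoint fun a => Metric.ball a (r / 2) :=
    fun a ha b hb hab => Metric.ball_disjoint_ball (by linarith [hsep ha hb hab])
  calc A.card * m = ∑ _ ∈ A, m := by simp
    _ ≤ ∑ a ∈ A, μ (Metric.ball a (r / 2)) := Finset.sum_le_sum hm
    _ = μ (⋃ a ∈ A, Metric.ball a (r / 2)) :=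
      (measure_biUnion_finset hdisj fun a _ => Metric.isOpen_ball.measurableSet).symm
    _ ≤ μ (Metric.ball x (s + r / 2)) := measure_mono <| Set.iUnion₂_subset fun a ha =>
      Metric.ball_subset_ball' (by linarith [hA a ha])

theorem exists_measure_ball_le_of_totallyBounded {Z : Type*} [PseudoMetricSpace Z]
    [MeasurableSpace Z] {μ : Measure Z} (htb : TotallyBounded (Set.univ : Set Z)) {C Δ Q : ℝ}
    (hC : 0 < C) (hΔ : 0 < Δ) (hQ : 0 < Q)
    (hμ : ∀ x r, 0 < r → r ≤ Δ → μ (Metric.ball x r) ≤ ENNReal.ofReal (C * r ^ Q)) :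
    ∃ C' : ℝ, 0 < C' ∧ ∀ x r, 0 < r → μ (Metric.ball x r) ≤ ENNReal.ofReal (C' * r ^ Q) := by
  have hfin : μ Set.univ < ∞ := by
    obtain ⟨t, ht, hcover⟩ := Metric.totallyBounded_iff.1 htb Δ hΔ
    exact (measure_mono hcover).trans_lt <| measure_biUnion_lt_top ht fun y _ =>
      (hμ y Δ hΔ le_rfl).trans_lt ENNReal.ofReal_lt_top
  set M := (μ Set.univ).toReal
  refine ⟨C + M / Δ ^ Q, by positivity, fun x r hr => ?_⟩
  rw [add_mul]
  rcases le_total r Δ with hrΔ | hrΔ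
  · refine (hμ x r hr hrΔ).trans (ENNReal.ofReal_le_ofReal (le_add_of_nonneg_right ?_))
    positivity
  · calc μ (Metric.ball x r) ≤ μ Set.univ := measure_mono (Set.subset_univ _)
      _ = ENNReal.ofReal (M / Δ ^ Q * Δ ^ Q) := by
        rw [div_mul_cancel₀ _ (by positivity), ENNReal.ofReal_toReal hfin.ne]
      _ ≤ ENNReal.ofReal (C * r ^ Q + M / Δ ^ Q * r ^ Q) := by
        refine ENNReal.ofReal_le_ofReal (le_add_of_nonneg_of_le (by positivity) ?_)
        gcongr

variable {Z : Type*} [MetricSpace Z]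

theorem exists_pos_forall_exists_le_dist [Nontrivial Z] :
    ∃ d : ℝ, 0 < d ∧ ∀ x : Z, ∃ z, d ≤ dist x z := by
  obtain ⟨a, b, hab⟩ := exists_pair_ne Z
  refine ⟨dist a b / 2, half_pos (dist_pos.2 hab), fun x => ?_⟩
  by_contra! h
  linarith [dist_triangle_left a b x, h a, h b]

theorem IsUniformlyPerfect.exists_dist_mem_Ico [Nontrivial Z] (hZ : IsUniformlyPerfect Z) {R : ℝ}
    (hR : 0 < R) :
    ∃ c : ℝ, 0 < c ∧ ∀ (x : Z) (r : ℝ), 0 < r → r ≤ R → ∃ y, dist x y ∈ Set.Ico (c * r) r := by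
  obtain ⟨c, hc, hperf⟩ := hZ
  obtain ⟨d, hd, hfar⟩ := exists_pos_forall_exists_le_dist (Z := Z)
  set t := min 1 (d / R)
  have : 0 < t := by positivity
  refine ⟨c * t, by positivity, fun x r hr hrR => ?_⟩
  obtain ⟨z, hz⟩ := hfar x
  have htr : t * r ≤ d :=
    calc t * r ≤ d / R * R := by gcongr; exact min_le_right _ _
      _ = d := by field_simp
  obtain ⟨y, hle, hlt⟩ := hperf x z (t * r) (by positivity) (htr.trans hz)
  exact ⟨y, (mul_assoc c t r).trans_le hle,
    hlt.trans_le (mul_le_of_le_one_left hr.le (min_le_left _ _))⟩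

variable [MeasurableSpace Z] [BorelSpace Z]

theorem IsAhlforsRegular.isDoubling (hZ : IsAhlforsRegular Z)
    (htb : TotallyBounded (Set.univ : Set Z)) : IsDoubling Z := by
  obtain ⟨Q, hQ, c, C, hc, hC, hreg⟩ := hZ
  rcases subsingleton_or_nontrivial Z with _ | _
  · exact fun T => ⟨1, fun _ _ _ _ _ _ => Finset.card_le_one_of_subsingleton _⟩
  have hle_diam : ∀ a b : Z, dist a b ≤ Metric.diam (Set.univ : Set Z) := fun a b =>
    Metric.dist_le_diam_of_mem htb.isBounded (Set.mem_univ a) (Set.mem_univ b)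
  have hdiam : 0 < Metric.diam (Set.univ : Set Z) := by
    obtain ⟨a, b, hab⟩ := exists_pair_ne Z
    exact (dist_pos.2 hab).trans_le (hle_diam a b)
  obtain ⟨C', hC', hup⟩ := exists_measure_ball_le_of_totallyBounded htb hC hdiam hQ
    fun x r hr hrΔ => (hreg x r hr hrΔ).2
  intro T
  obtain ⟨N, hN⟩ := exists_nat_ge (max 1 (C' * (T + 1 / 2) ^ Q / (c * (1 / 2) ^ Q)))
  refine ⟨N, fun x r hr A hA hsep => ?_⟩
  rcases le_or_gt A.card 1 with hcard | hcard
  · exact_mod_cast (Nat.cast_le.2 hcard).trans ((by simp : ((1 : ℕ) : ℝ) ≤ max 1 _).trans hN)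
  obtain ⟨a, ha, b, hb, hab⟩ := Finset.one_lt_card.1 hcard
  have hrΔ : r ≤ Metric.diam (Set.univ : Set Z) := (hsep ha hb hab).trans (hle_diam a b)
  have hT : 0 ≤ T := nonneg_of_mul_nonneg_left (dist_nonneg.trans (hA a ha)) hr
  have hpack := (card_mul_le_measure_ball (Measure.hausdorffMeasure Q) hA hsep fun a _ =>
    (hreg a (r / 2) (by positivity) (by linarith)).1).trans (hup x _ (by positivity))
  rw [← ENNReal.ofReal_natCast, ← ENNReal.ofReal_mul (by positivity),
    ENNReal.ofReal_le_ofReal_iff (by positivity), show r / 2 = 1 / 2 * r by ring, ← add_mul,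
    Real.mul_rpow (by positivity) hr.le, Real.mul_rpow (by positivity) hr.le] at hpack
  have hcancel : A.card * (c * (1 / 2) ^ Q) ≤ C' * (T + 1 / 2) ^ Q :=
    le_of_mul_le_mul_right (by linarith) (Real.rpow_pos_of_pos hr Q)
  rw [← le_div_iff₀ (by positivity)] at hcancel
  exact_mod_cast hcancel.trans ((le_max_right _ _).trans hN)

theorem IsAhlforsRegular.isUniformlyPerfect [BoundedSpace Z] (hZ : IsAhlforsRegular Z) :
    IsUniformlyPerfect Z := by
  obtain ⟨Q, hQ, c, C, hc, hC, hreg⟩ := hZ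
  set ε : ℝ := min 1 ((c / (2 * C)) ^ Q⁻¹)
  have hε : 0 < ε := by positivity
  have hεQ : C * ε ^ Q ≤ c / 2 :=
    calc C * ε ^ Q ≤ C * ((c / (2 * C)) ^ Q⁻¹) ^ Q := by gcongr; exact min_le_right _ _
      _ = c / 2 := by rw [Real.rpow_inv_rpow (by positivity) hQ.ne']; field_simp
  refine ⟨ε, hε, fun x z r hr hrz => ?_⟩
  by_contra! h
  have hsub : Metric.ball x r ⊆ Metric.ball x (ε * r) := fun y hy => by
    by_contra hy'
    rw [Metric.mem_ball'] at hy hy'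
    exact h y ⟨not_lt.1 hy', hy⟩
  have hrΔ : r ≤ Metric.diam (Set.univ : Set Z) :=
    hrz.trans (Metric.dist_le_diam_of_mem (Bornology.isBounded_univ.2 ‹_›)
      (Set.mem_univ x) (Set.mem_univ z))
  have hεr : ε * r ≤ r := mul_le_of_le_one_left hr.le (min_le_left _ _)
  have hle : c * r ^ Q ≤ C * (ε * r) ^ Q :=
    (ENNReal.ofReal_le_ofReal_iff (by positivity)).1 <| (hreg x r hr hrΔ).1.trans <|
      (measure_mono hsub).trans (hreg x (ε * r) (by positivity) (hεr.trans hrΔ)).2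
  rw [Real.mul_rpow hε.le hr.le, ← mul_assoc] at hle
  have hcε : c ≤ C * ε ^ Q := le_of_mul_le_mul_right hle (Real.rpow_pos_of_pos hr Q)
  linarith

end MetricNotions

section Quasisymmetry

/-- Bounded ratios of distances from a common point are sent to bounded ratios. This is the part
of quasisymmetry that does not involve small ratios. -/
def IsRatioBounded {Z W : Type*} [PseudoMetricSpace Z] [PseudoMetricSpace W] (f : Z → W) : Prop :=
  ∀ T : ℝ, ∃ T' : ℝ, ∀ x y z : Z,
    dist x y ≤ T * dist x z → dist (f x) (f y) ≤ T' * dist (f x) (f z)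

theorem isRatioBounded_id {Z : Type*} [PseudoMetricSpace Z] : IsRatioBounded (id : Z → Z) :=
  fun T => ⟨T, fun _ _ _ h => h⟩

theorem strictMono_homeomorph_nnreal (η : ℝ≥0 ≃ₜ ℝ≥0) : StrictMono η := by
  refine (η.continuous.strictMono_of_inj η.injective).resolve_right fun h => ?_
  obtain ⟨x, hx⟩ := η.surjective (η 0 + 1)
  exact (lt_add_one (η 0)).not_ge (hx ▸ h.antitone (zero_le (a := x)))

theorem homeomorph_nnreal_zero (η : ℝ≥0 ≃ₜ ℝ≥0) : η 0 = 0 :=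
  (StrictMono.orderIsoOfSurjective η (strictMono_homeomorph_nnreal η) η.surjective).map_bot

variable {Z W : Type*} [MetricSpace Z] [MetricSpace W]

theorem dist_le_of_nndist_div_le {f : Z ≃ₜ W} {η : ℝ≥0 ≃ₜ ℝ≥0}
    (hη : ∀ x y z : Z, x ≠ z →
      nndist (f x) (f y) / nndist (f x) (f z) ≤ η (nndist x y / nndist x z))
    {T : ℝ≥0} {x y z : Z} (h : dist x y ≤ T * dist x z) :
    dist (f x) (f y) ≤ η T * dist (f x) (f z) := by
  rcases eq_or_ne x z with rfl | hxz
  · obtain rfl : x = y := by simpa using h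
    simp
  have hpos : 0 < nndist x z := by simpa [pos_iff_ne_zero] using hxz
  have hpos' : 0 < nndist (f x) (f z) := by simpa [pos_iff_ne_zero] using hxz
  have hratio : nndist x y / nndist x z ≤ T := (div_le_iff₀ hpos).2 (by exact_mod_cast h)
  have himage := (hη x y z hxz).trans ((strictMono_homeomorph_nnreal η).monotone hratio)
  exact_mod_cast (div_le_iff₀ hpos').1 himage

theorem IsQuasisymmetry.isRatioBounded {f : Z ≃ₜ W} (hf : IsQuasisymmetry f) :
    IsRatioBounded f := by
  obtain ⟨η, hη⟩ := hf
  exact fun T => ⟨η T.toNNReal, fun x y z h => dist_le_of_nndist_div_le hη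
    (h.trans (mul_le_mul_of_nonneg_right (Real.le_coe_toNNReal T) dist_nonneg))⟩

theorem IsQuasisymmetry.isRatioBounded_symm {f : Z ≃ₜ W} (hf : IsQuasisymmetry f) :
    IsRatioBounded f.symm := by
  obtain ⟨η, hη⟩ := hf
  intro T
  set S := T.toNNReal
  set t : ℝ≥0 := η.symm (S + 1)⁻¹
  have hηt : η t = (S + 1)⁻¹ := η.apply_symm_apply _
  have ht0 : 0 < t := by
    rw [pos_iff_ne_zero]
    intro h
    rw [h, homeomorph_nnreal_zero] at hηt
    exact inv_ne_zero (by positivity) hηt.symm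
  -- A ratio above `t⁻¹` has an inverse below `t`, which `f` sends to a ratio at most `(S + 1)⁻¹`.
  refine ⟨(t : ℝ)⁻¹, fun x y z h => ?_⟩
  by_contra! hlt
  have hsmall : dist (f.symm x) (f.symm z) ≤ t * dist (f.symm x) (f.symm y) :=
    ((inv_mul_lt_iff₀ (NNReal.coe_pos.2 ht0)).1 hlt).le
  have hxz : (S + 1) * dist x z ≤ dist x y := by
    have := dist_le_of_nndist_div_le hη hsmall
    simp only [f.apply_symm_apply, hηt, NNReal.coe_inv] at this
    rw [le_inv_mul_iff₀ (by positivity)] at this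
    exact_mod_cast this
  have hxz0 : dist x z = 0 := by
    nlinarith [dist_nonneg (x := x) (y := z), Real.le_coe_toNNReal T]
  obtain rfl : x = y := dist_le_zero.1 (by rwa [hxz0, mul_zero] at h)
  rw [dist_self] at hlt
  exact hlt.not_ge (by positivity)

end Quasisymmetry

section ComparableBalls

/-- The balls with centres `p.1`, `q.1` and radii `p.2`, `q.2` have radii within a factor `T` of
each other, and their centres are at most `T` times either radius apart. -/
structure BallsComparable {Z : Type*} [PseudoMetricSpace Z] (T : ℝ) (p q : Z × ℝ) : Prop where
  pos_left : 0 < p.2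
  pos_right : 0 < q.2
  dist_le_left : dist p.1 q.1 ≤ T * p.2
  dist_le_right : dist p.1 q.1 ≤ T * q.2
  le_right : p.2 ≤ T * q.2
  le_left : q.2 ≤ T * p.2

/-- The ball centred at `a` with `b` on its boundary. -/
noncomputable def ballThrough {Z : Type*} [PseudoMetricSpace Z] (a b : Z) : Z × ℝ :=
  (a, dist a b)

namespace BallsComparable

variable {Z : Type*} [PseudoMetricSpace Z] {S T : ℝ} {p q o : Z × ℝ}

theorem of_dist_le (hq : 0 < q.2) (hdist : dist p.1 q.1 ≤ q.2) (hqp : q.2 ≤ p.2)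
    (hpq : p.2 ≤ T * q.2) : BallsComparable T p q := by
  have hT : 1 ≤ T := le_of_mul_le_mul_right (by linarith) hq
  have : q.2 ≤ T * q.2 := le_mul_of_one_le_left hq.le hT
  have hpT : p.2 ≤ T * p.2 := le_mul_of_one_le_left (hq.le.trans hqp) hT
  exact ⟨hq.trans_le hqp, hq, by linarith, by linarith, hpq, by linarith⟩

theorem pos (h : BallsComparable T p q) : 0 < T :=
  pos_of_mul_pos_left (h.pos_left.trans_le h.le_right) h.pos_right.le

theorem symm (h : BallsComparable T p q) : BallsComparable T q p where
  pos_left := h.pos_right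
  pos_right := h.pos_left
  dist_le_left := dist_comm p.1 q.1 ▸ h.dist_le_right
  dist_le_right := dist_comm p.1 q.1 ▸ h.dist_le_left
  le_right := h.le_left
  le_left := h.le_right

theorem trans (h : BallsComparable T p q) (h' : BallsComparable S q o) :
    BallsComparable (T * S + T + S) p o := by
  have htri := dist_triangle p.1 q.1 o.1
  have hq := mul_le_mul_of_nonneg_left h'.le_right h.pos.le
  have hq' := mul_le_mul_of_nonneg_left h.le_left h'.pos.le
  have hTp := mul_pos h.pos h.pos_left
  have hSp := mul_pos h'.pos h.pos_left
  have hTo := mul_pos h.pos h'.pos_right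
  have hSo := mul_pos h'.pos h'.pos_right
  refine ⟨h.pos_left, h'.pos_right, ?_, ?_, ?_, ?_⟩
  · linarith [h.dist_le_left, h'.dist_le_left]
  · linarith [h.dist_le_right, h'.dist_le_right]
  · linarith [h.le_right]
  · linarith [h'.le_left]

theorem mono (h : BallsComparable T p q) (hTS : T ≤ S) : BallsComparable S p q where
  pos_left := h.pos_left
  pos_right := h.pos_right
  dist_le_left := h.dist_le_left.trans (mul_le_mul_of_nonneg_right hTS h.pos_left.le)
  dist_le_right := h.dist_le_right.trans (mul_le_mul_of_nonneg_right hTS h.pos_right.le)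
  le_right := h.le_right.trans (mul_le_mul_of_nonneg_right hTS h.pos_right.le)
  le_left := h.le_left.trans (mul_le_mul_of_nonneg_right hTS h.pos_left.le)

end BallsComparable

theorem IsRatioBounded.exists_ballsComparable {Z W : Type*} [PseudoMetricSpace Z] [MetricSpace W]
    {f : Z → W} (hf : IsRatioBounded f) (hinj : Function.Injective f) (T : ℝ) :
    ∃ T' : ℝ, ∀ a b c d : Z, BallsComparable T (ballThrough a b) (ballThrough c d) →
      BallsComparable T' (ballThrough (f a) (f b)) (ballThrough (f c) (f d)) := by
  obtain ⟨T₁, h₁⟩ := hf T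
  obtain ⟨T₂, h₂⟩ := hf (2 * T)
  have hpos : ∀ a b, 0 < dist a b → 0 < dist (f a) (f b) := by
    rintro a b h
    exact dist_pos.2 (hinj.ne (by rintro rfl; simp at h))
  have hhalf : ∀ a b c d : Z, BallsComparable T (ballThrough a b) (ballThrough c d) →
      dist (f a) (f c) ≤ T₁ * dist (f c) (f d) ∧
      dist (f a) (f b) ≤ (T₁ + T₂) * dist (f c) (f d) := by
    intro a b c d h
    obtain ⟨-, -, -, hac, hab, -⟩ := h
    simp only [ballThrough] at hac hab
    have hca := h₁ c a d (dist_comm a c ▸ hac)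
    have hcb := h₂ c b d (by linarith [dist_triangle c a b, dist_comm a c])
    rw [dist_comm (f a) (f c)]
    exact ⟨hca, by linarith [dist_triangle (f a) (f c) (f b), dist_comm (f c) (f a)]⟩
  refine ⟨max T₁ (T₁ + T₂), fun a b c d h => ?_⟩
  have hab := hpos a b h.pos_left
  have hcd := hpos c d h.pos_right
  obtain ⟨hac, hle⟩ := hhalf a b c d h
  obtain ⟨hca, hge⟩ := hhalf c d a b h.symm
  refine ⟨hab, hcd, ?_, ?_, ?_, ?_⟩ <;> simp only [ballThrough]
  · rw [dist_comm]
    exact hca.trans (by gcongr; exact le_max_left _ _)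
  · exact hac.trans (by gcongr; exact le_max_left _ _)
  · exact hle.trans (by gcongr; exact le_max_right _ _)
  · exact hge.trans (by gcongr; exact le_max_right _ _)

end ComparableBalls

namespace BallKind

variable {Z : Type*} [MetricSpace Z] {κ : BallKind} {x y z : Z} {r s : ℝ}

theorem mem_ball_of_dist_lt (h : dist z x < r) : z ∈ κ.ball x r := by
  cases κ
  exacts [h, h.le]

theorem dist_le_of_mem_ball (h : z ∈ κ.ball x r) : dist z x ≤ r := by
  cases κ
  exacts [le_of_lt h, h]

theorem ball_subset_ball (h : s + dist y x ≤ r) : κ.ball y s ⊆ κ.ball x r := by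
  cases κ
  exacts [Metric.ball_subset_ball' h, Metric.closedBall_subset_closedBall' h]

end BallKind

namespace HyperbolicFilling

variable {Z : Type*} [MetricSpace Z] {X : HyperbolicFilling Z}

section Radius

/-- The radius `r n` of the covering balls of level `n`. -/
noncomputable def rad (X : HyperbolicFilling Z) (n : ℕ) : ℝ := X.scale / X.ratio ^ n

theorem ratio_pos : 0 < X.ratio := one_pos.trans X.one_lt_ratio

theorem rad_pos (n : ℕ) : 0 < X.rad n := X.radius_pos n

theorem ratio_pow_mul_rad_add (n k : ℕ) : X.ratio ^ k * X.rad (n + k) = X.rad n := by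
  have := ratio_pos (X := X)
  rw [rad, rad, pow_add]
  field_simp

theorem ratio_mul_rad_succ (n : ℕ) : X.ratio * X.rad (n + 1) = X.rad n := by
  simpa using ratio_pow_mul_rad_add (X := X) n 1

theorem rad_strictAnti : StrictAnti X.rad := by
  refine strictAnti_nat_of_succ_lt fun n => ?_
  rw [← ratio_mul_rad_succ n]
  exact lt_mul_of_one_lt_left (rad_pos _) X.one_lt_ratio

theorem rad_zero : X.rad 0 = X.scale := by simp [rad]

theorem rad_le_scale (n : ℕ) : X.rad n ≤ X.scale :=
  rad_zero (X := X) ▸ rad_strictAnti.antitone (Nat.zero_le n)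

theorem exists_rad_le {t : ℝ} (ht : 0 < t) : ∃ n, X.rad n ≤ t := by
  obtain ⟨n, hn⟩ := pow_unbounded_of_one_lt (X.scale / t) X.one_lt_ratio
  refine ⟨n, (div_le_iff₀ (pow_pos ratio_pos n)).2 ?_⟩
  linarith [(div_lt_iff₀ ht).1 hn]

theorem le_add_of_rad_le {T : ℝ} {k m n : ℕ} (hT : T ≤ X.ratio ^ k)
    (h : X.rad m ≤ T * X.rad n) : n ≤ m + k := by
  refine (rad_strictAnti (X := X)).le_iff_ge.1
    (le_of_mul_le_mul_left ?_ (pow_pos (ratio_pos (X := X)) k))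
  rw [ratio_pow_mul_rad_add]
  exact h.trans (mul_le_mul_of_nonneg_right hT (rad_pos n).le)

end Radius

section GraphMetric

theorem dist_eq (v w : X.Vertex) : dist v w = X.graph.dist v w := rfl

theorem dist_le_one_of_adj {v w : X.Vertex} (h : X.graph.Adj v w) : dist v w ≤ 1 := by
  rw [dist_eq, SimpleGraph.dist_eq_one_iff_adj.2 h, Nat.cast_one]

theorem isUniformlyDiscrete_vertex (X : HyperbolicFilling Z) : IsUniformlyDiscrete X.Vertex :=
  ⟨1, one_pos, fun _ _ h => by
    rw [dist_eq]
    exact_mod_cast X.graph_connected.pos_dist_of_ne h⟩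

theorem dist_level_le_dist (v w : X.Vertex) : dist v.level w.level ≤ dist v w := by
  refine (dist_le_mul_graphDist X.graph_connected (L := 1) (fun v w h => ?_) v w).trans_eq
    (one_mul _)
  have hle : v.level ≤ w.level + 1 ∧ w.level ≤ v.level + 1 := by
    rcases h.2 with h | h | h <;> omega
  rw [Nat.dist_eq, abs_sub_le_iff, sub_le_iff_le_add', sub_le_iff_le_add']
  exact_mod_cast hle

theorem eq_of_level_eq_zero {v w : X.Vertex} (hv : v.level = 0) (hw : w.level = 0) : v = w := by
  obtain ⟨p, hp⟩ := X.net_zero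
  have hvp : v.center = p := by simpa [hv, hp] using v.mem
  have hwp : w.center = p := by simpa [hw, hp] using w.mem
  exact Vertex.ext (hv.trans hw.symm) (hvp.trans hwp.symm)

/-- The covering ball `B (p, r n)` of the vertex contains `z`. -/
def Near (v : X.Vertex) (z : Z) : Prop := dist z v.center < X.rad v.level

theorem near_center (v : X.Vertex) : Near v v.center :=
  (dist_self v.center).trans_lt (rad_pos v.level)

theorem exists_near (X : HyperbolicFilling Z) (n : ℕ) (z : Z) :
    ∃ v : X.Vertex, v.level = n ∧ Near v z := by
  obtain ⟨p, hp, h⟩ := X.covers n z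
  exact ⟨⟨n, p, hp⟩, rfl, h⟩

theorem dist_le_one_of_level_eq {v w : X.Vertex} {z z' : Z} (hv : Near v z) (hw : Near w z')
    (hl : v.level = w.level) (h : dist z z' ≤ (X.hFactor - 1) * X.rad w.level) :
    dist v w ≤ 1 := by
  rcases eq_or_ne v w with rfl | hne
  · simp
  have hv' : dist z v.center < X.rad v.level := hv
  have hw' : dist z' w.center < X.rad w.level := hw
  refine dist_le_one_of_adj ⟨hne, Or.inl ⟨hl, z', BallKind.mem_ball_of_dist_lt ?_,
    BallKind.mem_ball_of_dist_lt (hw'.trans ?_)⟩⟩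
  · change _ < X.hFactor * X.rad v.level
    rw [hl] at hv' ⊢
    linarith [dist_triangle_left z' v.center z]
  · exact lt_mul_of_one_lt_left (rad_pos _) X.one_lt_hFactor

theorem dist_le_one_of_level_succ {v w : X.Vertex} {z : Z} (hv : Near v z) (hw : Near w z)
    (hl : w.level = v.level + 1) : dist v w ≤ 1 := by
  refine dist_le_one_of_adj ⟨fun h => by simp [h] at hl, Or.inr (Or.inl ⟨hl, ?_⟩)⟩
  cases hrule : X.vRule with
  | overlap =>
    exact ⟨z, BallKind.mem_ball_of_dist_lt
        (hv.trans_le (le_mul_of_one_le_left (rad_pos _).le X.one_le_vFactor)),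
      BallKind.mem_ball_of_dist_lt
        (hw.trans_le (le_mul_of_one_le_left (rad_pos _).le X.one_le_vFactor))⟩
  | containment =>
    refine BallKind.ball_subset_ball ?_
    change X.vFactor * X.rad w.level + dist w.center v.center ≤ X.vFactor * X.rad v.level
    have hrad : X.rad v.level = X.ratio * X.rad w.level := by rw [hl, ratio_mul_rad_succ]
    have hdist : dist w.center v.center ≤ X.rad v.level + X.rad w.level := by
      rw [Near] at hv hw
      linarith [dist_triangle_left w.center v.center z]
    have hratio := ratio_pos (X := X)
    calc X.vFactor * X.rad w.level + dist w.center v.center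
        ≤ X.vFactor * X.rad w.level + (X.rad v.level + X.rad w.level) := by gcongr
      _ = (1 + (1 + X.vFactor) / X.ratio) * X.rad v.level := by
        rw [hrad]
        field_simp
        ring
      _ ≤ X.vFactor * X.rad v.level :=
        mul_le_mul_of_nonneg_right (X.vFactor_large hrule) (rad_pos _).le

theorem dist_le_of_near {z : Z} (k : ℕ) {v w : X.Vertex} (hv : Near v z) (hw : Near w z)
    (hl : w.level = v.level + k) : dist v w ≤ k + 1 := by
  induction k generalizing w with
  | zero =>
    have hF : 0 ≤ (X.hFactor - 1) * X.rad w.level :=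
      mul_nonneg (sub_nonneg.2 X.one_lt_hFactor.le) (rad_pos _).le
    simpa using dist_le_one_of_level_eq hv hw hl.symm ((dist_self z).trans_le hF)
  | succ k ih =>
    obtain ⟨u, hu, huz⟩ := X.exists_near (v.level + k) z
    have hvu := ih huz hu
    have huw := dist_le_one_of_level_succ huz hw (by omega)
    push_cast
    linarith [dist_triangle v u w]

theorem dist_le_of_common_level {z z' : Z} {v w : X.Vertex} (hv : Near v z) (hw : Near w z')
    {j k l : ℕ} (hk : v.level = j + k) (hl : w.level = j + l)
    (h : j = 0 ∨ dist z z' ≤ (X.hFactor - 1) * X.rad j) : dist v w ≤ k + l + 3 := by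
  obtain ⟨u, hu, huz⟩ := X.exists_near j z
  obtain ⟨u', hu', huz'⟩ := X.exists_near j z'
  have huv := dist_le_of_near k huz hv (by omega)
  have huw := dist_le_of_near l huz' hw (by omega)
  have huu' : dist u u' ≤ 1 := by
    rcases h with rfl | h
    · simp [eq_of_level_eq_zero hu hu']
    · exact dist_le_one_of_level_eq huz huz' (hu.trans hu'.symm) (hu' ▸ h)
  linarith [dist_triangle v u w, dist_triangle u u' w, dist_comm v u]

end GraphMetric

section VertexBalls

/-- The covering ball of a vertex, as a pair of centre and radius. -/
noncomputable def Vertex.toBall (v : X.Vertex) : Z × ℝ := (v.center, X.rad v.level)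

theorem exists_dist_le_of_ballsComparable (X : HyperbolicFilling Z) (T : ℝ) :
    ∃ D : ℝ, ∀ v w : X.Vertex, BallsComparable T v.toBall w.toBall → dist v w ≤ D := by
  have hF : 0 < X.hFactor - 1 := sub_pos.2 X.one_lt_hFactor
  obtain ⟨k, hk⟩ := pow_unbounded_of_one_lt (max T (T / (X.hFactor - 1))) X.one_lt_ratio
  obtain ⟨hTk, hTFk⟩ := max_lt_iff.1 hk
  rw [div_lt_iff₀ hF] at hTFk
  refine ⟨4 * k + 3, fun v w h => ?_⟩
  have hwv : w.level ≤ v.level + k := le_add_of_rad_le hTk.le h.le_right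
  have hvw : v.level ≤ w.level + k := le_add_of_rad_le hTk.le h.le_left
  set j := min v.level w.level - k with hj
  obtain ⟨a, ha⟩ := Nat.exists_eq_add_of_le (show j ≤ v.level by rw [hj]; omega)
  obtain ⟨b, hb⟩ := Nat.exists_eq_add_of_le (show j ≤ w.level by omega)
  have hclose : j = 0 ∨ dist v.center w.center ≤ (X.hFactor - 1) * X.rad j := by
    refine j.eq_zero_or_pos.imp_right fun hjpos => ?_
    have hjk : X.rad v.level ≤ X.rad (j + k) := rad_strictAnti.antitone (by omega)
    have hratio : 0 < X.ratio ^ k := pow_pos ratio_pos k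
    calc dist v.center w.center ≤ T * X.rad v.level := h.dist_le_left
      _ ≤ (X.ratio ^ k * (X.hFactor - 1)) * X.rad (j + k) :=
        mul_le_mul hTFk.le hjk (rad_pos _).le (by positivity)
      _ = (X.hFactor - 1) * X.rad j := by rw [← ratio_pow_mul_rad_add j k]; ring
  have hdist := dist_le_of_common_level (near_center v) (near_center w) ha hb hclose
  have hab : (a : ℝ) + b ≤ 4 * k := by exact_mod_cast (by omega : a + b ≤ 4 * k)
  linarith

theorem ballsComparable_of_nonempty_inter {κ : BallKind} {F : ℝ} (hF : 1 ≤ F) {v w : X.Vertex}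
    (hvw : v.level ≤ w.level) (hwv : w.level ≤ v.level + 1)
    (h : (κ.ball v.center (F * X.rad v.level) ∩ κ.ball w.center (F * X.rad w.level)).Nonempty) :
    BallsComparable (2 * F * X.ratio) v.toBall w.toBall := by
  obtain ⟨z, hzv, hzw⟩ := h
  have hratio := X.one_lt_ratio
  have hr := rad_pos (X := X) v.level
  have hr' := rad_pos (X := X) w.level
  have hle : X.rad w.level ≤ X.rad v.level := rad_strictAnti.antitone hvw
  have hge : X.rad v.level ≤ X.ratio * X.rad w.level := by
    rw [← ratio_mul_rad_succ v.level]
    gcongr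
    exact rad_strictAnti.antitone hwv
  have hdist : dist v.center w.center ≤ 2 * F * X.rad v.level := by
    have := mul_le_mul_of_nonneg_left hle (zero_le_one.trans hF)
    linarith [dist_triangle_left v.center w.center z, BallKind.dist_le_of_mem_ball hzv,
      BallKind.dist_le_of_mem_ball hzw]
  have hdist' : dist v.center w.center ≤ 2 * F * X.ratio * X.rad w.level :=
    hdist.trans (by rw [mul_assoc (2 * F)]; gcongr)
  have hone : 1 ≤ 2 * F := by linarith
  refine ⟨hr, hr', hdist'.trans (by simp only [Vertex.toBall]; gcongr), hdist', ?_,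
    hle.trans (le_mul_of_one_le_left hr.le (one_le_mul_of_one_le_of_one_le hone hratio.le))⟩
  simp only [Vertex.toBall]
  rw [mul_assoc]
  exact hge.trans (le_mul_of_one_le_left (by positivity) hone)

theorem vBall_inter_nonempty_of_holds {v w : X.Vertex}
    (h : X.vRule.holds (X.vBall v) (X.vBall w)) : (X.vBall v ∩ X.vBall w).Nonempty := by
  cases hrule : X.vRule with
  | overlap => rwa [hrule] at h
  | containment =>
    rw [hrule] at h
    have hw : w.center ∈ X.vBall w := BallKind.mem_ball_of_dist_lt <|
      (dist_self _).trans_lt (mul_pos (one_pos.trans_le X.one_le_vFactor) (rad_pos w.level))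
    exact ⟨w.center, h hw, hw⟩

theorem exists_ballsComparable_of_adj (X : HyperbolicFilling Z) :
    ∃ C : ℝ, ∀ v w : X.Vertex, X.graph.Adj v w → BallsComparable C v.toBall w.toBall := by
  have hratio := ratio_pos (X := X)
  have hvert : ∀ v w : X.Vertex, w.level = v.level + 1 → X.vRule.holds (X.vBall v) (X.vBall w) →
      BallsComparable (2 * max X.hFactor X.vFactor * X.ratio) v.toBall w.toBall :=
    fun v w hl h => (ballsComparable_of_nonempty_inter X.one_le_vFactor (by omega) hl.le
      (vBall_inter_nonempty_of_holds h)).mono (by gcongr; exact le_max_right _ _)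
  refine ⟨2 * max X.hFactor X.vFactor * X.ratio, fun v w h => ?_⟩
  rcases h.2 with ⟨hl, h⟩ | ⟨hl, h⟩ | ⟨hl, h⟩
  · exact (ballsComparable_of_nonempty_inter X.one_lt_hFactor.le hl.le (by omega) h).mono
      (by gcongr; exact le_max_left _ _)
  · exact hvert v w hl h
  · exact (hvert w v hl h).symm

theorem ballsComparable_self (v : X.Vertex) : BallsComparable 1 v.toBall v.toBall :=
  .of_dist_le (rad_pos _) ((dist_self _).trans_le (rad_pos _).le) le_rfl (one_mul _).ge

theorem exists_ballsComparable_of_dist_le (X : HyperbolicFilling Z) (k : ℕ) :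
    ∃ C : ℝ, ∀ v w : X.Vertex, dist v w ≤ k → BallsComparable C v.toBall w.toBall := by
  obtain ⟨C₁, h₁⟩ := X.exists_ballsComparable_of_adj
  have hwalk : ∃ C : ℝ, ∀ {v w : X.Vertex} (p : X.graph.Walk v w), p.length ≤ k →
      BallsComparable C v.toBall w.toBall := by
    induction k with
    | zero =>
      refine ⟨1, fun p hp => ?_⟩
      obtain rfl := p.eq_of_length_eq_zero (by omega)
      exact ballsComparable_self _
    | succ k ih =>
      obtain ⟨C, hC⟩ := ih
      refine ⟨max 1 (C₁ * C + C₁ + C), fun p hp => ?_⟩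
      cases p with
      | nil => exact (ballsComparable_self _).mono (le_max_left _ _)
      | cons h p =>
        rw [SimpleGraph.Walk.length_cons] at hp
        exact ((h₁ _ _ h).trans (hC p (by omega))).mono (le_max_right _ _)
  obtain ⟨C, hC⟩ := hwalk
  refine ⟨C, fun v w hvw => ?_⟩
  obtain ⟨p, hp⟩ := X.graph_connected.exists_walk_length_eq_dist v w
  rw [dist_eq, ← hp] at hvw
  exact hC p (by exact_mod_cast hvw)

theorem exists_ballsComparable_ballThrough_center [Nontrivial Z] (hZ : IsUniformlyPerfect Z)
    (X : HyperbolicFilling Z) :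
    ∃ K : ℝ, ∀ v : X.Vertex, ∃ b, BallsComparable K v.toBall (ballThrough v.center b) := by
  obtain ⟨c, hc, hperf⟩ := hZ.exists_dist_mem_Ico X.scale_pos
  refine ⟨c⁻¹, fun v => ?_⟩
  obtain ⟨b, hcb, hb⟩ := hperf v.center _ (rad_pos v.level) (rad_le_scale v.level)
  refine ⟨b, .of_dist_le ((mul_pos hc (rad_pos v.level)).trans_le hcb) ?_ hb.le
    ((le_inv_mul_iff₀ hc).2 hcb)⟩
  simp [Vertex.toBall, ballThrough]

theorem dist_lt_two_mul_scale (X : HyperbolicFilling Z) (a b : Z) : dist a b < 2 * X.scale := by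
  obtain ⟨u, hu, hua⟩ := X.exists_near 0 a
  obtain ⟨v, hv, hvb⟩ := X.exists_near 0 b
  obtain rfl := eq_of_level_eq_zero hu hv
  rw [Near, hu, rad_zero] at hua hvb
  linarith [dist_triangle_right a b u.center]

theorem exists_vertex_ballsComparable_ballThrough (X : HyperbolicFilling Z) :
    ∃ K : ℝ, ∀ a b : Z, a ≠ b → ∃ v : X.Vertex, BallsComparable K (ballThrough a b) v.toBall := by
  classical
  refine ⟨max 2 X.ratio, fun a b hab => ?_⟩
  have hex : ∃ n, X.rad n ≤ dist a b := exists_rad_le (dist_pos.2 hab)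
  obtain ⟨v, hv, hva⟩ := X.exists_near (Nat.find hex) a
  have hle : dist a b ≤ max 2 X.ratio * X.rad v.level := by
    have hr := rad_pos (X := X) v.level
    cases hn : v.level with
    | zero =>
      rw [hn, rad_zero] at hr
      calc dist a b ≤ 2 * X.scale := (X.dist_lt_two_mul_scale a b).le
        _ ≤ max 2 X.ratio * X.rad 0 := by rw [rad_zero]; gcongr; exact le_max_left _ _
    | succ n =>
      rw [hn] at hr
      calc dist a b ≤ X.rad n := (not_le.1 (Nat.find_min hex (by omega))).le
        _ = X.ratio * X.rad (n + 1) := (ratio_mul_rad_succ n).symm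
        _ ≤ max 2 X.ratio * X.rad (n + 1) := by gcongr; exact le_max_right _ _
  exact ⟨v, .of_dist_le (rad_pos _) (le_of_lt hva)
    (by simpa [Vertex.toBall, ballThrough, hv] using Nat.find_spec hex) hle⟩

end VertexBalls

end HyperbolicFilling

namespace HyperbolicFilling

variable {Z : Type*} [MetricSpace Z]

section VertexGeometry

theorem exists_card_le_of_level_eq (hZ : IsDoubling Z) (X : HyperbolicFilling Z) (C : ℝ) :
    ∃ N : ℕ, ∀ (x : Z) (n : ℕ) (A : Finset X.Vertex), (∀ w ∈ A, w.level = n) →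
      (∀ w ∈ A, dist w.center x ≤ C * X.rad n) → A.card ≤ N := by
  classical
  obtain ⟨N, hN⟩ := hZ (C / X.sep)
  have hsep := X.sep_pos
  refine ⟨N, fun x n A hlevel hdist => ?_⟩
  have hinj : Set.InjOn Vertex.center (A : Set X.Vertex) := fun v hv w hw h =>
    Vertex.ext ((hlevel v hv).trans (hlevel w hw).symm) h
  rw [← Finset.card_image_of_injOn hinj]
  refine hN x (X.sep * X.rad n) (mul_pos hsep (rad_pos n)) _ ?_ ?_
  · intro a ha
    obtain ⟨w, hw, rfl⟩ := Finset.mem_image.1 ha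
    exact (hdist w hw).trans_eq (by field_simp)
  · intro a ha b hb hab
    obtain ⟨v, hv, rfl⟩ := Finset.mem_image.1 (Finset.mem_coe.1 ha)
    obtain ⟨w, hw, rfl⟩ := Finset.mem_image.1 (Finset.mem_coe.1 hb)
    exact X.separated n (hlevel v hv ▸ v.mem) (hlevel w hw ▸ w.mem) hab

theorem hasBoundedGeometry_vertex (hZ : IsDoubling Z) (X : HyperbolicFilling Z) :
    HasBoundedGeometry X.Vertex := by
  intro r
  set k := ⌈r⌉₊
  obtain ⟨C, hC⟩ := X.exists_ballsComparable_of_dist_le k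
  obtain ⟨N, hN⟩ := X.exists_card_le_of_level_eq hZ C
  refine ⟨N * (2 * k + 1), fun v => encard_le_of_forall_finset_card_le fun A hA => ?_⟩
  have hk : ∀ w ∈ A, dist w v ≤ k := fun w hw => (hA hw).trans (Nat.le_ceil r)
  have hlevels : A.image Vertex.level ⊆ Finset.Icc (v.level - k) (v.level + k) := by
    intro n hn
    obtain ⟨w, hw, rfl⟩ := Finset.mem_image.1 hn
    have hwv := (dist_level_le_dist w v).trans (hk w hw)
    rw [Nat.dist_eq, abs_sub_le_iff, sub_le_iff_le_add', sub_le_iff_le_add'] at hwv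
    norm_cast at hwv
    rw [Finset.mem_Icc]
    omega
  have hcard : (A.image Vertex.level).card ≤ 2 * k + 1 := by
    refine (Finset.card_le_card hlevels).trans ?_
    rw [Nat.card_Icc]
    omega
  refine (Finset.card_le_mul_card_image A N fun n _ => ?_).trans (Nat.mul_le_mul_left N hcard)
  refine hN v.center n _ (fun w hw => (Finset.mem_filter.1 hw).2) fun w hw => ?_
  obtain ⟨hwA, rfl⟩ := Finset.mem_filter.1 hw
  exact (hC w v (hk w hwA)).dist_le_left

theorem exists_near_dist_lt [Nontrivial Z] (hZ : IsUniformlyPerfect Z) (X : HyperbolicFilling Z) :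
    ∃ c : ℝ, 0 < c ∧ ∀ v : X.Vertex, ∃ y, Near v y ∧ c * X.rad v.level ≤ dist y v.center ∧
      dist y v.center < X.sep / 4 * X.rad v.level := by
  obtain ⟨c, hc, hperf⟩ := hZ.exists_dist_mem_Ico X.scale_pos
  set σ := min 1 (X.sep / 4)
  have hsep := X.sep_pos
  have hσ : 0 < σ := by positivity
  refine ⟨c * σ, by positivity, fun v => ?_⟩
  have hr := rad_pos (X := X) v.level
  have hσr : σ * X.rad v.level ≤ X.rad v.level := mul_le_of_le_one_left hr.le (min_le_left _ _)
  obtain ⟨y, hle, hlt⟩ := hperf v.center _ (mul_pos hσ hr) (hσr.trans (rad_le_scale _))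
  rw [dist_comm] at hle hlt
  exact ⟨y, hlt.trans_le hσr, (mul_assoc c σ _).trans_le hle,
    hlt.trans_le (mul_le_mul_of_nonneg_right (min_le_right _ _) hr.le)⟩

theorem exists_children [Nontrivial Z] (hZ : IsUniformlyPerfect Z) (X : HyperbolicFilling Z) :
    ∃ (k : ℕ) (child : X.Vertex × Bool → X.Vertex),
      (∀ p, (child p).level = p.1.level + k) ∧ (∀ p, dist (child p) p.1 ≤ k + 1) ∧
      (∀ p, dist (child p).center p.1.center < X.sep / 2 * X.rad p.1.level) ∧
      ∀ v, child (v, false) ≠ child (v, true) := by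
  obtain ⟨c, hc, hy⟩ := X.exists_near_dist_lt hZ
  choose y hnear hle hlt using hy
  obtain ⟨k, hk⟩ := pow_unbounded_of_one_lt (2 / c) X.one_lt_ratio
  have hrad : ∀ v : X.Vertex, 2 * X.rad (v.level + k) ≤ c * X.rad v.level := fun v => by
    rw [← ratio_pow_mul_rad_add v.level k, ← mul_assoc, mul_comm c]
    exact mul_le_mul_of_nonneg_right ((div_lt_iff₀ hc).1 hk).le (rad_pos _).le
  set z : X.Vertex × Bool → Z := fun p => bif p.2 then y p.1 else p.1.center
  have hz : ∀ p, Near p.1 (z p) := by rintro ⟨v, _ | _⟩; exacts [near_center v, hnear v]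
  choose child hlevel hchild using fun p : X.Vertex × Bool => X.exists_near (p.1.level + k) (z p)
  have hdist : ∀ p, dist (z p) (child p).center < X.rad (p.1.level + k) :=
    fun p => hlevel p ▸ hchild p
  refine ⟨k, child, hlevel, fun p => ?_, fun p => ?_, fun v h => ?_⟩
  · rw [dist_comm]
    exact dist_le_of_near k (hz p) (hchild p) (hlevel p)
  · have hz' : dist (z p) p.1.center ≤ dist (y p.1) p.1.center := by
      obtain ⟨v, _ | _⟩ := p
      exacts [(dist_self v.center).trans_le dist_nonneg, le_rfl]
    linarith [dist_triangle_left (child p).center p.1.center (z p), hdist p, hrad p.1,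
      hle p.1, hlt p.1, rad_pos (X := X) (p.1.level + k)]
  · have hfalse : dist v.center (child (v, false)).center < _ := hdist (v, false)
    have htrue : dist (y v) (child (v, true)).center < _ := hdist (v, true)
    rw [← h] at htrue
    linarith [dist_triangle_right (y v) v.center (child (v, false)).center, hle v, hrad v]

theorem isParadoxical_vertex [Nontrivial Z] (hZ : IsUniformlyPerfect Z) (X : HyperbolicFilling Z) :
    IsParadoxical X.Vertex := by
  obtain ⟨k, child, hlevel, hdist, hcenter, hne⟩ := X.exists_children hZ
  refine ⟨child, ?_, k + 1, hdist⟩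
  rintro ⟨v, i⟩ ⟨w, j⟩ h
  have hl : w.level = v.level := by
    have := hlevel (v, i)
    rw [h, hlevel] at this
    exact Nat.add_right_cancel this
  obtain rfl : v = w := by
    by_contra hvw
    have hsep : X.sep * X.rad v.level ≤ dist v.center w.center :=
      X.separated v.level v.mem (hl ▸ w.mem) fun hc => hvw (Vertex.ext hl.symm hc)
    have hv := hcenter (v, i)
    have hw := hcenter (w, j)
    simp only [h, hl] at hv hw
    linarith [dist_triangle_left v.center w.center (child (w, j)).center]
  cases i <;> cases j
  exacts [rfl, absurd h (hne v), absurd h.symm (hne v), rfl]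

end VertexGeometry

section Extension

variable {W U : Type*} [MetricSpace W] [MetricSpace U] {X : HyperbolicFilling Z}
  {Y : HyperbolicFilling W} {V : HyperbolicFilling U}

/-- The map `F` of vertices is induced by the map `f` of the underlying spaces: if the ball of `v`
is comparable to the ball through the points `a` and `b`, then the ball of `F v` is comparable to
the ball through `f a` and `f b`. -/
def Extends (F : X.Vertex → Y.Vertex) (f : Z → W) : Prop :=
  ∀ T : ℝ, ∃ T' : ℝ, ∀ (v : X.Vertex) (a b : Z), BallsComparable T v.toBall (ballThrough a b) →
    BallsComparable T' (F v).toBall (ballThrough (f a) (f b))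

theorem extends_id : Extends (id : X.Vertex → X.Vertex) id :=
  fun T => ⟨T, fun _ _ _ h => h⟩

theorem Extends.comp {F : X.Vertex → Y.Vertex} {G : Y.Vertex → V.Vertex} {f : Z → W} {g : W → U}
    (hG : Extends G g) (hF : Extends F f) : Extends (G ∘ F) (g ∘ f) := by
  intro T
  obtain ⟨T', hT'⟩ := hF T
  obtain ⟨T'', hT''⟩ := hG T'
  exact ⟨T'', fun v a b h => hT'' _ _ _ (hT' v a b h)⟩

theorem Extends.isClose [Nontrivial Z] (hZ : IsUniformlyPerfect Z) {F F' : X.Vertex → Y.Vertex}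
    {f : Z → W} (hF : Extends F f) (hF' : Extends F' f) : IsClose F F' := by
  obtain ⟨K, hK⟩ := X.exists_ballsComparable_ballThrough_center hZ
  obtain ⟨T, hT⟩ := hF K
  obtain ⟨T', hT'⟩ := hF' K
  obtain ⟨D, hD⟩ := Y.exists_dist_le_of_ballsComparable (T * T' + T + T')
  refine ⟨D, fun v => ?_⟩
  obtain ⟨b, hb⟩ := hK v
  exact hD _ _ ((hT v _ b hb).trans (hT' v _ b hb).symm)

theorem Extends.exists_lipschitzWith [Nontrivial Z] (hZ : IsUniformlyPerfect Z)
    {F : X.Vertex → Y.Vertex} {f : Z → W} (hF : Extends F f) : ∃ K, LipschitzWith K F := by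
  obtain ⟨C, hC⟩ := X.exists_ballsComparable_of_adj
  obtain ⟨K, hK⟩ := X.exists_ballsComparable_ballThrough_center hZ
  obtain ⟨T, hT⟩ := hF (C * K + C + K)
  obtain ⟨T', hT'⟩ := hF K
  obtain ⟨D, hD⟩ := Y.exists_dist_le_of_ballsComparable (T * T' + T + T')
  refine ⟨_, LipschitzWith.of_dist_le' (K := D)
    (dist_le_mul_graphDist X.graph_connected fun v w h => ?_)⟩
  obtain ⟨b, hb⟩ := hK w
  exact hD _ _ ((hT v _ b ((hC v w h).trans hb)).trans (hT' w _ b hb).symm)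

theorem exists_extends [Nontrivial Z] (hZ : IsUniformlyPerfect Z) (X : HyperbolicFilling Z)
    (Y : HyperbolicFilling W) {f : Z → W} (hf : IsRatioBounded f) (hinj : Function.Injective f) :
    ∃ F : X.Vertex → Y.Vertex, Extends F f := by
  obtain ⟨K, hK⟩ := X.exists_ballsComparable_ballThrough_center hZ
  obtain ⟨K', hK'⟩ := Y.exists_vertex_ballsComparable_ballThrough
  choose b hb using hK
  have hne : ∀ v : X.Vertex, f v.center ≠ f (b v) := fun v =>
    hinj.ne (dist_pos.1 (hb v).pos_right)
  choose F hF using fun v => hK' _ _ (hne v)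
  refine ⟨F, fun T => ?_⟩
  obtain ⟨T', hT'⟩ := hf.exists_ballsComparable hinj (K * T + K + T)
  exact ⟨_, fun v a a' h => (hF v).symm.trans (hT' _ _ _ _ ((hb v).symm.trans h))⟩

end Extension

section Bilipschitz

variable {W : Type*} [MetricSpace W]

theorem bilipschitzEquivalent_of_isRatioBounded [Nontrivial Z] (hZ : IsDoubling Z)
    (hZ' : IsUniformlyPerfect Z) (hW : IsDoubling W) (hW' : IsUniformlyPerfect W)
    (X : HyperbolicFilling Z) (Y : HyperbolicFilling W) (e : Z ≃ W) (he : IsRatioBounded e)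
    (he' : IsRatioBounded e.symm) : BilipschitzEquivalent X.Vertex Y.Vertex := by
  have := e.symm.nontrivial
  obtain ⟨F, hF⟩ := exists_extends hZ' X Y he e.injective
  obtain ⟨G, hG⟩ := exists_extends hW' Y X he' e.symm.injective
  obtain ⟨K, hK⟩ := hF.exists_lipschitzWith hZ'
  obtain ⟨K', hK'⟩ := hG.exists_lipschitzWith hW'
  have hGF : Extends (G ∘ F) id := e.symm_comp_self ▸ hG.comp hF
  have hFG : Extends (F ∘ G) id := e.self_comp_symm ▸ hF.comp hG
  exact bilipschitzEquivalent_of_isParadoxical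
    X.isUniformlyDiscrete_vertex (X.hasBoundedGeometry_vertex hZ) (X.isParadoxical_vertex hZ')
    Y.isUniformlyDiscrete_vertex (Y.hasBoundedGeometry_vertex hW) (Y.isParadoxical_vertex hW')
    hK hK' (hGF.isClose hZ' extends_id) (hFG.isClose hW' extends_id)

theorem dist_eq_dist_level [Subsingleton Z] {X : HyperbolicFilling Z} (v w : X.Vertex) :
    dist v w = dist v.level w.level := by
  have hle : ∀ (k : ℕ) (v w : X.Vertex), w.level = v.level + k → dist v w ≤ k := by
    intro k v
    induction k with
    | zero =>
      intro w hw
      simp [Vertex.ext hw (Subsingleton.elim w.center v.center)]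
    | succ k ih =>
      intro w hw
      obtain ⟨u, hu, huw⟩ := X.exists_parent (v.level + k) w hw
      push_cast
      linarith [dist_triangle v u w, ih u hu, dist_le_one_of_adj huw]
  refine (dist_level_le_dist v w).antisymm' ?_
  wlog h : v.level ≤ w.level generalizing v w
  · rw [dist_comm, dist_comm v.level]
    exact this w v (le_of_not_ge h)
  obtain ⟨k, hk⟩ := Nat.exists_eq_add_of_le h
  exact (hle k v w hk).trans_eq (by simp [hk, Nat.dist_eq])

theorem nonempty_isometryEquiv_nat [Subsingleton Z] (X : HyperbolicFilling Z) :
    Nonempty (X.Vertex ≃ᵢ ℕ) := by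
  obtain ⟨p, -⟩ := X.net_zero
  have hiso : Isometry (Vertex.level : X.Vertex → ℕ) :=
    Isometry.of_dist_eq fun v w => (dist_eq_dist_level v w).symm
  exact ⟨⟨Equiv.ofBijective Vertex.level
    ⟨hiso.injective, fun n => (X.exists_near n p).imp fun _ h => h.1⟩, hiso⟩⟩

theorem bilipschitzEquivalent_of_subsingleton [Subsingleton Z] [Subsingleton W]
    (X : HyperbolicFilling Z) (Y : HyperbolicFilling W) :
    BilipschitzEquivalent X.Vertex Y.Vertex := by
  obtain ⟨eX⟩ := X.nonempty_isometryEquiv_nat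
  obtain ⟨eY⟩ := Y.nonempty_isometryEquiv_nat
  exact bilipschitzEquivalent_of_lipschitzWith (eX.trans eY.symm).toEquiv
    (eX.trans eY.symm).isometry.lipschitz (eX.trans eY.symm).symm.isometry.lipschitz

theorem bilipschitzEquivalent_of_equiv (hZ : IsDoubling Z) (hZ' : IsUniformlyPerfect Z)
    (hW : IsDoubling W) (hW' : IsUniformlyPerfect W) (X : HyperbolicFilling Z)
    (Y : HyperbolicFilling W) (e : Z ≃ W) (he : IsRatioBounded e) (he' : IsRatioBounded e.symm) :
    BilipschitzEquivalent X.Vertex Y.Vertex := by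
  rcases subsingleton_or_nontrivial Z with _ | _
  · have := e.symm.subsingleton
    exact bilipschitzEquivalent_of_subsingleton X Y
  · exact bilipschitzEquivalent_of_isRatioBounded hZ hZ' hW hW' X Y e he he'

end Bilipschitz

end HyperbolicFilling

theorem corollary2_general {Z W : Type*} [MetricSpace Z] [MetricSpace W]
    (hZ : IsDoubling Z) (hZ' : IsUniformlyPerfect Z)
    (hW : IsDoubling W) (hW' : IsUniformlyPerfect W) :
    (QuasisymmetricallyEquivalent Z W →
      ∀ (X : HyperbolicFilling Z) (Y : HyperbolicFilling W),
        BilipschitzEquivalent X.Vertex Y.Vertex) ∧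
    (∀ X X' : HyperbolicFilling Z, BilipschitzEquivalent X.Vertex X'.Vertex) := by
  refine ⟨fun ⟨f, hf⟩ X Y => ?_, fun X X' => ?_⟩
  · exact HyperbolicFilling.bilipschitzEquivalent_of_equiv hZ hZ' hW hW' X Y f.toEquiv
      hf.isRatioBounded hf.isRatioBounded_symm
  · exact HyperbolicFilling.bilipschitzEquivalent_of_equiv hZ hZ' hZ hZ' X X' (Equiv.refl Z)
      isRatioBounded_id isRatioBounded_id

theorem corollary2 {Z W : Type*}
    [MetricSpace Z] [CompactSpace Z] [MeasurableSpace Z] [BorelSpace Z]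
    [MetricSpace W] [CompactSpace W] [MeasurableSpace W] [BorelSpace W]
    (hZ : IsAhlforsRegular Z) (hW : IsAhlforsRegular W) :
    (QuasisymmetricallyEquivalent Z W →
      ∀ (X : HyperbolicFilling Z) (Y : HyperbolicFilling W),
        BilipschitzEquivalent X.Vertex Y.Vertex) ∧
    (∀ X X' : HyperbolicFilling Z, BilipschitzEquivalent X.Vertex X'.Vertex) :=
  corollary2_general (hZ.isDoubling isCompact_univ.totallyBounded) hZ.isUniformlyPerfect
    (hW.isDoubling isCompact_univ.totallyBounded) hW.isUniformlyPerfect
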